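/- For real $t$ and integers $m\ge 1$, $a$, let $\pi(t;m,a)$ denote the number of primes $p\le t$ with $p\equiv a \pmod m$, and let $\varphi$ be Euler's totient function. There exist absolute constants $C>0$, $\epsilon_0>0$ and $x_0$ such that for every $\epsilon$ with $0<\epsilon<\epsilon_0$ and every real $x\ge x_0$, $$\sum_{1\le m\le x^{1-\epsilon}}\varphi(m)\left(\int_{2}^{m^{1+\epsilon}}\frac{\pi(t;m,1)}{(t-1)^2}\,dt\right)^2\le C\left(\epsilon\log x+\log\log x\right),$$ where $m$ runs over positive integers (for $m=1$ the integral, whose upper limit is then $1$, equals $0$, since $\pi(t;1,1)=0$ for $t<2$). -/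

import Mathlib

/-- `π(t; m, a)`: the number of primes `p ≤ t` with `p ≡ a (mod m)`. -/
noncomputable def primesInAP (t : ℝ) (m a : ℕ) : ℕ :=
  ((Finset.Iic ⌊t⌋₊).filter (fun p => p.Prime ∧ p ≡ a [MOD m])).card

open ArithmeticFunction in
/-- For a squarefree `n` and `c ∣ n`, the Möbius sum over the multiples of `c` dividing `n`. -/
theorem sum_moebius_divisors_filter_dvd {n c : ℕ} (hn : Squarefree n) (hc : c ∣ n) :
    ∑ d ∈ n.divisors with c ∣ d, (moebius d : ℝ) = if c = n then (moebius n : ℝ) else 0 := by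
  obtain ⟨e, rfl⟩ := hc
  have h0 : c * e ≠ 0 := hn.ne_zero
  have hc0 : c ≠ 0 := left_ne_zero_of_mul h0
  have he0 : e ≠ 0 := right_ne_zero_of_mul h0
  have hco : c.Coprime e := Nat.coprime_of_squarefree_mul hn
  have himg : {d ∈ (c * e).divisors | c ∣ d} = e.divisors.image (c * ·) := by
    ext d
    simp only [Finset.mem_filter, Nat.mem_divisors, Finset.mem_image]
    constructor
    · rintro ⟨⟨hd, -⟩, t, rfl⟩
      exact ⟨t, ⟨Nat.dvd_of_mul_dvd_mul_left (Nat.pos_of_ne_zero hc0) hd, he0⟩, rfl⟩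
    · rintro ⟨t, ⟨ht, -⟩, rfl⟩
      exact ⟨⟨mul_dvd_mul_left c ht, h0⟩, dvd_mul_right c t⟩
  rw [himg, Finset.sum_image (fun a _ b _ h => Nat.eq_of_mul_eq_mul_left
    (Nat.pos_of_ne_zero hc0) h)]
  have hmul : ∀ t ∈ e.divisors, ((moebius (c * t) : ℤ) : ℝ) = moebius c * moebius t := by
    intro t ht
    rw [isMultiplicative_moebius.map_mul_of_coprime
      (hco.coprime_dvd_right (Nat.dvd_of_mem_divisors ht))]
    push_cast; rfl
  rw [Finset.sum_congr rfl hmul, ← Finset.mul_sum]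
  have hz : ∑ t ∈ e.divisors, ((moebius t : ℤ) : ℝ) = if e = 1 then 1 else 0 := by
    have h := congrArg (fun f : ArithmeticFunction ℤ => f e) coe_zeta_mul_moebius
    simp only [coe_zeta_mul_apply, one_apply] at h
    exact_mod_cast h
  rw [hz]
  by_cases h1 : e = 1
  · simp [h1]
  · have : c ≠ c * e := fun h => h1 (by simpa [hc0] using h.symm)
    simp [h1, this]

open ArithmeticFunction in
/-- Orthogonality of the divisor sums `∑_{d ∣ m} μ(d) d 1_{d ∣ k}` for squarefree moduli. -/
theorem sum_sum_moebius_mul_gcd {m n : ℕ} (hm : Squarefree m) (hn : Squarefree n) :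
    ∑ d ∈ m.divisors, ∑ e ∈ n.divisors, (moebius d : ℝ) * moebius e * (d.gcd e : ℝ) =
      if m = n then (m.totient : ℝ) else 0 := by
  have hg : ∀ d ∈ m.divisors, ∀ e ∈ n.divisors, (moebius d : ℝ) * moebius e * (d.gcd e : ℝ) =
      ∑ c ∈ m.divisors, (c.totient : ℝ) * (if c ∣ d then (moebius d : ℝ) else 0) *
        (if c ∣ e then (moebius e : ℝ) else 0) := by
    intro d hd e he
    have hd' := Nat.dvd_of_mem_divisors hd
    have hd0 : d ≠ 0 := fun h => hm.ne_zero (by simpa [h] using hd')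
    have hs : ((d.gcd e : ℕ) : ℝ) = ∑ c ∈ m.divisors with c ∣ d ∧ c ∣ e, (c.totient : ℝ) := by
      conv_lhs => rw [← Nat.sum_totient (d.gcd e)]
      push_cast
      refine Finset.sum_congr ?_ fun _ _ => rfl
      ext c
      simp only [Nat.mem_divisors, Finset.mem_filter, Nat.dvd_gcd_iff]
      constructor
      · rintro ⟨⟨h1, h2⟩, -⟩
        exact ⟨⟨h1.trans hd', hm.ne_zero⟩, h1, h2⟩
      · rintro ⟨-, h1, h2⟩
        exact ⟨⟨h1, h2⟩, (Nat.gcd_pos_of_pos_left _ (Nat.pos_of_ne_zero hd0)).ne'⟩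
    rw [hs, Finset.sum_filter, Finset.mul_sum]
    refine Finset.sum_congr rfl fun c _ => ?_
    by_cases h1 : c ∣ d <;> by_cases h2 : c ∣ e <;> simp [h1, h2]
    ring
  rw [Finset.sum_congr rfl fun d hd => Finset.sum_congr rfl (hg d hd)]
  have hswap : ∑ d ∈ m.divisors, ∑ e ∈ n.divisors, ∑ c ∈ m.divisors,
      (c.totient : ℝ) * (if c ∣ d then (moebius d : ℝ) else 0) *
        (if c ∣ e then (moebius e : ℝ) else 0) =
      ∑ c ∈ m.divisors, (c.totient : ℝ) * (∑ d ∈ m.divisors with c ∣ d, (moebius d : ℝ)) *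
        (∑ e ∈ n.divisors with c ∣ e, (moebius e : ℝ)) := by
    simp_rw [Finset.sum_filter, mul_assoc, Finset.sum_mul_sum, Finset.mul_sum]
    rw [Finset.sum_congr rfl fun d _ => Finset.sum_comm, Finset.sum_comm]
  rw [hswap, Finset.sum_congr rfl fun c hc => by
    rw [sum_moebius_divisors_filter_dvd hm (Nat.dvd_of_mem_divisors hc)]]
  rw [Finset.sum_eq_single m]
  · rw [if_pos rfl]
    by_cases hmn : m ∣ n
    · rw [sum_moebius_divisors_filter_dvd hn hmn]
      by_cases h : m = n
      · subst h
        have hsq : (moebius m : ℝ) * moebius m = 1 := by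
          have := moebius_sq_eq_one_of_squarefree hm
          rw [sq] at this
          exact_mod_cast this
        simp [mul_assoc, hsq]
      · simp [h]
    · have h : m ≠ n := fun h => hmn (h ▸ dvd_rfl)
      have : {e ∈ n.divisors | m ∣ e} = ∅ := by
        ext e
        simp only [Finset.mem_filter, Nat.mem_divisors, Finset.notMem_empty, iff_false]
        exact fun ⟨⟨h1, _⟩, h2⟩ => hmn (h2.trans h1)
      simp [this, h]
  · intro c _ hcm
    simp [hcm]
  · intro h
    exact absurd (Nat.mem_divisors_self m hm.ne_zero) h

/-- The number of `k ≤ K` with `q ∣ k m + 1` is `K / q` up to an error of at most one. -/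
theorem abs_card_dvd_mul_add_one_sub_le {q m : ℕ} (hq : 0 < q) (h : q.Coprime m) (K : ℕ) :
    |(((Finset.Icc 1 K).filter fun k => q ∣ k * m + 1).card : ℝ) - (K : ℝ) / q| ≤ 1 := by
  obtain ⟨v, hv⟩ : ∃ v : ℕ, ∀ k : ℕ, q ∣ k * m + 1 ↔ k ≡ v [MOD q] := by
    have : NeZero q := ⟨hq.ne'⟩
    have hu : IsUnit (m : ZMod q) := (ZMod.isUnit_iff_coprime m q).2 h.symm
    obtain ⟨u, hu⟩ := hu
    refine ⟨(-(↑u⁻¹ : ZMod q)).val, fun k => ?_⟩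
    rw [← ZMod.natCast_eq_zero_iff, ← ZMod.natCast_eq_natCast_iff, ZMod.natCast_zmod_val]
    push_cast
    rw [← hu, ← eq_neg_iff_add_eq_zero, ← Units.eq_mul_inv_iff_mul_eq]
    simp
  have hset : ((Finset.Icc 1 K).filter fun k => q ∣ k * m + 1) =
      (Finset.Ioc 0 K).filter fun k => k ≡ v [MOD q] := by
    ext k
    simp [hv, Finset.mem_Icc, Finset.mem_Ioc, Nat.succ_le_iff]
  rw [hset]
  have hc := Nat.Ioc_filter_modEq_card 0 K hq v
  have hq' : (0 : ℚ) < q := by exact_mod_cast hq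
  have hle : ⌊(((0 : ℕ) : ℚ) - v) / q⌋ ≤ ⌊((K : ℚ) - v) / q⌋ := by
    apply Int.floor_le_floor
    gcongr
    simp
  rw [max_eq_left (by simpa using hle)] at hc
  have h1 := Int.floor_le (((K : ℚ) - v) / q)
  have h2 := Int.lt_floor_add_one (((K : ℚ) - v) / q)
  have h3 := Int.floor_le ((((0 : ℕ) : ℚ) - v) / q)
  have h4 := Int.lt_floor_add_one ((((0 : ℕ) : ℚ) - v) / q)
  have hc' := congrArg (fun z : ℤ => (z : ℚ)) hc
  simp only [Int.cast_natCast, Int.cast_sub] at hc'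
  have key : |((((Finset.Ioc 0 K).filter fun k => k ≡ v [MOD q]).card : ℕ) : ℚ) - (K : ℚ) / q|
      ≤ 1 := by
    have e1 : ((K : ℚ) - v) / q = K / q - v / q := sub_div _ _ _
    have e2 : (((0 : ℕ) : ℚ) - v) / q = -(v / q) := by simp [neg_div]
    rw [hc', abs_le]
    generalize ⌊((K : ℚ) - v) / q⌋ = A at *
    generalize ⌊(((0 : ℕ) : ℚ) - v) / q⌋ = B at *
    rw [e1] at h1 h2
    rw [e2] at h3 h4
    constructor <;> linarith
  have keyReal := (Rat.cast_le (K := ℝ)).2 key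
  push_cast at keyReal
  exact keyReal

/-- The sum of the reciprocals of the divisors of `n`, that is `σ(n) / n`. -/
noncomputable def sumInvDivisors (n : ℕ) : ℝ := ∑ d ∈ n.divisors, (d : ℝ)⁻¹

theorem sumInvDivisors_nonneg (n : ℕ) : 0 ≤ sumInvDivisors n :=
  Finset.sum_nonneg fun _ _ => by positivity

theorem one_le_sumInvDivisors {n : ℕ} (hn : n ≠ 0) : 1 ≤ sumInvDivisors n := by
  have h : (fun d : ℕ => (d : ℝ)⁻¹) 1 ≤ sumInvDivisors n :=
    Finset.single_le_sum (f := fun d : ℕ => (d : ℝ)⁻¹) (fun _ _ => by positivity)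
      (Nat.one_mem_divisors.2 hn)
  simpa using h

theorem sumInvDivisors_eq_sum_div (n : ℕ) :
    sumInvDivisors n = (∑ d ∈ n.divisors, (d : ℝ)) / n := by
  rw [sumInvDivisors, ← Nat.sum_div_divisors n (fun d => (d : ℝ)⁻¹), Finset.sum_div]
  refine Finset.sum_congr rfl fun d hd => ?_
  rw [Nat.cast_div (Nat.dvd_of_mem_divisors hd)
    (by exact_mod_cast (Nat.pos_of_mem_divisors hd).ne'), inv_div]

theorem sum_Icc_inv_sq_le_two (n : ℕ) : ∑ b ∈ Finset.Icc 1 n, ((b : ℝ) ^ 2)⁻¹ ≤ 2 := by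
  have h := sum_Ioo_inv_sq_le (α := ℝ) 0 (n + 1)
  have he : Finset.Ioo 0 (n + 1) = Finset.Icc 1 n := by ext; simp; lia
  rw [he] at h
  simpa using h

theorem sum_sumInvDivisors_le (n : ℕ) :
    ∑ j ∈ Finset.Icc 1 n, sumInvDivisors j ≤ 2 * n := by
  have h1 : ∀ j ∈ Finset.Icc 1 n, sumInvDivisors j =
      ∑ d ∈ Finset.Icc 1 n, if d ∣ j then (d : ℝ)⁻¹ else 0 := by
    intro j hj
    rw [Finset.mem_Icc] at hj
    rw [sumInvDivisors, ← Finset.sum_filter]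
    refine Finset.sum_congr ?_ fun _ _ => rfl
    ext d
    simp only [Nat.mem_divisors, Finset.mem_filter, Finset.mem_Icc]
    constructor
    · rintro ⟨h, -⟩
      exact ⟨⟨Nat.pos_of_dvd_of_pos h hj.1, (Nat.le_of_dvd hj.1 h).trans hj.2⟩, h⟩
    · rintro ⟨-, h⟩
      exact ⟨h, by lia⟩
  rw [Finset.sum_congr rfl h1, Finset.sum_comm]
  have h2 : ∀ d ∈ Finset.Icc 1 n, ∑ j ∈ Finset.Icc 1 n, (if d ∣ j then (d : ℝ)⁻¹ else 0) ≤
      n * ((d : ℝ) ^ 2)⁻¹ := by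
    intro d hd
    have hd0 : (0 : ℝ) < d := by exact_mod_cast (Finset.mem_Icc.1 hd).1
    rw [← Finset.sum_filter, Finset.sum_const, nsmul_eq_mul]
    have hc : ((Finset.Icc 1 n).filter fun j => d ∣ j).card = n / d := by
      rw [← Nat.Ioc_filter_dvd_card_eq_div n d]
      rfl
    rw [hc]
    have : ((n / d : ℕ) : ℝ) ≤ n / d := Nat.cast_div_le
    calc ((n / d : ℕ) : ℝ) * (d : ℝ)⁻¹ ≤ (n / d) * (d : ℝ)⁻¹ := by gcongr
      _ = n * ((d : ℝ) ^ 2)⁻¹ := by field_simp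
  calc _ ≤ ∑ d ∈ Finset.Icc 1 n, (n : ℝ) * ((d : ℝ) ^ 2)⁻¹ := Finset.sum_le_sum h2
    _ = n * ∑ d ∈ Finset.Icc 1 n, ((d : ℝ) ^ 2)⁻¹ := by rw [Finset.mul_sum]
    _ ≤ n * 2 := by gcongr; exact sum_Icc_inv_sq_le_two n
    _ = 2 * n := by ring

theorem totient_mul_le (a b : ℕ) : (a * b).totient ≤ a * b.totient := by
  rcases Nat.eq_zero_or_pos b with rfl | hb
  · simp
  calc (a * b).totient = ((Finset.range (a * b)).filter (a * b).Coprime).card := rfl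
    _ ≤ ((Finset.range (a * b)).filter b.Coprime).card :=
        Finset.card_le_card fun x hx => by
          rw [Finset.mem_filter] at hx ⊢
          exact ⟨hx.1, Nat.Coprime.coprime_mul_left hx.2⟩
    _ ≤ a * b.totient := by
        induction a with
        | zero => simp
        | succ a ih =>
          rw [Nat.succ_mul, Nat.succ_mul]
          calc _ ≤ (((Finset.range (a * b)).filter b.Coprime) ∪
                ((Finset.Ico (a * b) (a * b + b)).filter b.Coprime)).card := by
                refine Finset.card_le_card fun x hx => ?_
                simp only [Finset.mem_union, Finset.mem_filter, Finset.mem_range,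
                  Finset.mem_Ico] at hx ⊢
                rcases lt_or_ge x (a * b) with h | h
                · exact Or.inl ⟨h, hx.2⟩
                · exact Or.inr ⟨⟨h, hx.1⟩, hx.2⟩
            _ ≤ _ := (Finset.card_union_le _ _).trans
                (add_le_add ih (Nat.filter_coprime_Ico_eq_totient b (a * b)).le)

theorem totient_mul_sumInvDivisors_le (n : ℕ) : (n.totient : ℝ) * sumInvDivisors n ≤ n := by
  calc (n.totient : ℝ) * sumInvDivisors n
      = ∑ d ∈ n.divisors, (n.totient : ℝ) * (d : ℝ)⁻¹ := by rw [sumInvDivisors, Finset.mul_sum]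
    _ ≤ ∑ d ∈ n.divisors, ((n / d).totient : ℝ) := by
        refine Finset.sum_le_sum fun d hd => ?_
        have hd0 : (0 : ℝ) < d := by exact_mod_cast Nat.pos_of_mem_divisors hd
        rw [← div_eq_mul_inv, div_le_iff₀ hd0]
        have h := totient_mul_le d (n / d)
        rw [Nat.mul_div_cancel' (Nat.dvd_of_mem_divisors hd)] at h
        rw [mul_comm]
        exact_mod_cast h
    _ = n := by
        rw [Nat.sum_div_divisors n (fun d => (d.totient : ℝ))]
        exact_mod_cast Nat.sum_totient n

/-- The squarefree positive integers up to `z` coprime to `m`. -/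
def sqfreeCoprime (m z : ℕ) : Finset ℕ :=
  (Finset.Icc 1 z).filter fun d => Squarefree d ∧ d.Coprime m

theorem log_le_two_mul_sumInvDivisors_mul_sum {m : ℕ} (hm : m ≠ 0) (z : ℕ) :
    Real.log (z + 1 : ℝ) ≤ 2 * sumInvDivisors m * ∑ d ∈ sqfreeCoprime m z, (d : ℝ)⁻¹ := by
  let T := Finset.Icc 1 z ×ˢ m.divisors ×ˢ sqfreeCoprime m z
  let g : ℕ × ℕ × ℕ → ℕ := fun t => t.1 ^ 2 * (t.2.1 * t.2.2)
  have hsub : Finset.Icc 1 z ⊆ T.image g := by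
    intro n hn
    rw [Finset.mem_Icc] at hn
    obtain ⟨s, b, hs, hb, hsb, hsq⟩ := Nat.sq_mul_squarefree_of_pos hn.1
    obtain ⟨e, he⟩ := Nat.gcd_dvd_left s m
    have hsn : s ≤ n := hsb ▸ Nat.le_mul_of_pos_left s (by positivity)
    have hbn : b ≤ n := by
      rw [← hsb]
      nlinarith [Nat.mul_le_mul (Nat.mul_le_mul hb (le_refl b)) hs]
    have he0 : 0 < e := Nat.pos_of_ne_zero fun h => by rw [h] at he; lia
    have hge : (s.gcd m).Coprime e := Nat.coprime_of_squarefree_mul (he ▸ hsq)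
    have hem : e.Coprime m := by
      have hes : e ∣ s := Dvd.intro_left _ he.symm
      have : e.gcd m ∣ s.gcd m := Nat.gcd_dvd_gcd_of_dvd_left m hes
      exact Nat.eq_one_of_dvd_coprimes hge this (Nat.gcd_dvd_left e m)
    refine Finset.mem_image.2 ⟨(b, s.gcd m, e), ?_, ?_⟩
    · simp only [T, sqfreeCoprime, Finset.mem_product, Finset.mem_Icc, Nat.mem_divisors,
        Finset.mem_filter]
      refine ⟨⟨hb, hbn.trans hn.2⟩, ⟨Nat.gcd_dvd_right s m, hm⟩, ⟨he0, ?_⟩, ?_, hem⟩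
      · exact (Nat.le_of_dvd hs (Dvd.intro_left _ he.symm)).trans (hsn.trans hn.2)
      · exact hsq.squarefree_of_dvd (Dvd.intro_left _ he.symm)
    · simp only [g]
      rw [← he, hsb]
  have hharm : Real.log (z + 1 : ℝ) ≤ ∑ n ∈ Finset.Icc 1 z, (n : ℝ)⁻¹ := by
    have h := log_add_one_le_harmonic z
    rw [harmonic_eq_sum_Icc] at h
    push_cast at h
    exact h
  have himg : ∑ n ∈ T.image g, (n : ℝ)⁻¹ ≤ ∑ t ∈ T, ((g t : ℕ) : ℝ)⁻¹ := by
    rw [← Finset.sum_fiberwise_of_maps_to (s := T) (t := T.image g) (g := g)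
      (fun t ht => Finset.mem_image_of_mem g ht)]
    refine Finset.sum_le_sum fun n hn => ?_
    obtain ⟨t, ht, rfl⟩ := Finset.mem_image.1 hn
    exact Finset.single_le_sum (f := fun t => ((g t : ℕ) : ℝ)⁻¹) (fun _ _ => by positivity)
      (Finset.mem_filter.2 ⟨ht, rfl⟩)
  have hprod : ∑ t ∈ T, ((g t : ℕ) : ℝ)⁻¹ = (∑ b ∈ Finset.Icc 1 z, ((b : ℝ) ^ 2)⁻¹) *
      (sumInvDivisors m * ∑ d ∈ sqfreeCoprime m z, (d : ℝ)⁻¹) := by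
    rw [sumInvDivisors, Finset.sum_mul_sum, ← Finset.sum_product', Finset.sum_mul_sum,
      ← Finset.sum_product']
    refine Finset.sum_congr rfl fun t _ => ?_
    simp only [g]
    push_cast
    rw [mul_inv, mul_inv]
  calc Real.log (z + 1 : ℝ) ≤ _ := hharm
    _ ≤ ∑ n ∈ T.image g, (n : ℝ)⁻¹ :=
        Finset.sum_le_sum_of_subset_of_nonneg hsub fun _ _ _ => by positivity
    _ ≤ _ := himg
    _ = _ := hprod
    _ ≤ 2 * (sumInvDivisors m * ∑ d ∈ sqfreeCoprime m z, (d : ℝ)⁻¹) := by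
        gcongr
        · exact mul_nonneg (sumInvDivisors_nonneg m) (Finset.sum_nonneg fun _ _ => by positivity)
        · exact sum_Icc_inv_sq_le_two z
    _ = _ := by ring

open ArithmeticFunction in
/-- The divisor sum `∑_{d ∣ q, d ∣ n} μ(d) d`. -/
noncomputable def moebiusDivisorSum (q n : ℕ) : ℝ :=
  ∑ d ∈ q.divisors, if d ∣ n then (moebius d : ℝ) * d else 0

theorem moebiusDivisorSum_of_coprime {q n : ℕ} (hq : q ≠ 0) (h : q.Coprime n) :
    moebiusDivisorSum q n = 1 := by
  rw [moebiusDivisorSum, Finset.sum_eq_single 1]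
  · simp
  · intro d hd hd1
    rw [if_neg]
    intro hdn
    exact hd1 (Nat.eq_one_of_dvd_coprimes h (Nat.dvd_of_mem_divisors hd) hdn)
  · intro h1
    exact absurd (Nat.one_mem_divisors.2 hq) h1

open ArithmeticFunction in
theorem sum_moebiusDivisorSum_mul_le {q r m : ℕ} (hq : Squarefree q) (hr : Squarefree r)
    (hqm : q.Coprime m) (hrm : r.Coprime m) (K : ℕ) :
    ∑ k ∈ Finset.Icc 1 K, moebiusDivisorSum q (k * m + 1) * moebiusDivisorSum r (k * m + 1) ≤
      (if q = r then (K : ℝ) * q.totient else 0) +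
        (∑ d ∈ q.divisors, (d : ℝ)) * ∑ e ∈ r.divisors, (e : ℝ) := by
  have hterm : ∀ d ∈ q.divisors, ∀ e ∈ r.divisors,
      ∑ k ∈ Finset.Icc 1 K, ((if d ∣ k * m + 1 then (moebius d : ℝ) * d else 0) *
        (if e ∣ k * m + 1 then (moebius e : ℝ) * e else 0)) ≤
      (K : ℝ) * ((moebius d : ℝ) * moebius e * (d.gcd e : ℝ)) + (d : ℝ) * e := by
    intro d hd e he
    have hd0 := Nat.pos_of_mem_divisors hd
    have he0 := Nat.pos_of_mem_divisors he
    have hl0 : 0 < d.lcm e := Nat.lcm_pos hd0 he0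
    have hco : (d.lcm e).Coprime m :=
      Nat.Coprime.coprime_dvd_left (Nat.lcm_dvd_mul d e)
        (Nat.Coprime.mul_left (hqm.coprime_dvd_left (Nat.dvd_of_mem_divisors hd))
          (hrm.coprime_dvd_left (Nat.dvd_of_mem_divisors he)))
    have hN := abs_card_dvd_mul_add_one_sub_le hl0 hco K
    have hsum : ∑ k ∈ Finset.Icc 1 K, ((if d ∣ k * m + 1 then (moebius d : ℝ) * d else 0) *
        (if e ∣ k * m + 1 then (moebius e : ℝ) * e else 0)) =
        ((moebius d : ℝ) * moebius e * ((d : ℝ) * e)) *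
          (((Finset.Icc 1 K).filter fun k => d.lcm e ∣ k * m + 1).card : ℝ) := by
      rw [Finset.card_filter, Nat.cast_sum, Finset.mul_sum]
      refine Finset.sum_congr rfl fun k _ => ?_
      simp only [Nat.lcm_dvd_iff]
      by_cases h1 : d ∣ k * m + 1 <;> by_cases h2 : e ∣ k * m + 1 <;> simp [h1, h2]
      ring
    rw [hsum]
    generalize (((Finset.Icc 1 K).filter fun k => d.lcm e ∣ k * m + 1).card : ℝ) = N at hN ⊢
    have hgl : (d.gcd e : ℝ) * (d.lcm e : ℝ) = d * e := by exact_mod_cast Nat.gcd_mul_lcm d e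
    have hl : (0 : ℝ) < (d.lcm e : ℝ) := by exact_mod_cast hl0
    have hmu : |(moebius d : ℝ) * moebius e| ≤ 1 := by
      rw [abs_mul]
      have h1 : |(moebius d : ℝ)| ≤ 1 := by exact_mod_cast abs_moebius_le_one (n := d)
      have h2 : |(moebius e : ℝ)| ≤ 1 := by exact_mod_cast abs_moebius_le_one (n := e)
      exact mul_le_one₀ h1 (abs_nonneg _) h2
    have hde : (0 : ℝ) ≤ (d : ℝ) * e := by positivity
    have hdiff : ((moebius d : ℝ) * moebius e * ((d : ℝ) * e)) * N -
        (K : ℝ) * ((moebius d : ℝ) * moebius e * (d.gcd e : ℝ)) =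
        ((moebius d : ℝ) * moebius e) * ((d : ℝ) * e) * (N - K / (d.lcm e : ℝ)) := by
      rw [← hgl]
      field_simp
    have hle : ((moebius d : ℝ) * moebius e) * ((d : ℝ) * e) * (N - K / (d.lcm e : ℝ)) ≤
        (d : ℝ) * e := by
      refine (le_abs_self _).trans ?_
      rw [abs_mul, abs_mul, abs_of_nonneg hde]
      calc |(moebius d : ℝ) * moebius e| * ((d : ℝ) * e) * |N - K / (d.lcm e : ℝ)|
          ≤ 1 * ((d : ℝ) * e) * 1 := by gcongr
        _ = _ := by ring
    linarith
  calc _ = ∑ d ∈ q.divisors, ∑ e ∈ r.divisors,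
        ∑ k ∈ Finset.Icc 1 K, ((if d ∣ k * m + 1 then (moebius d : ℝ) * d else 0) *
        (if e ∣ k * m + 1 then (moebius e : ℝ) * e else 0)) := by
        simp_rw [moebiusDivisorSum, Finset.sum_mul_sum]
        rw [Finset.sum_comm]
        exact Finset.sum_congr rfl fun d _ => Finset.sum_comm
    _ ≤ ∑ d ∈ q.divisors, ∑ e ∈ r.divisors,
        ((K : ℝ) * ((moebius d : ℝ) * moebius e * (d.gcd e : ℝ)) + (d : ℝ) * e) :=
        Finset.sum_le_sum fun d hd => Finset.sum_le_sum fun e he => hterm d hd e he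
    _ = (K : ℝ) * (∑ d ∈ q.divisors, ∑ e ∈ r.divisors,
          (moebius d : ℝ) * moebius e * (d.gcd e : ℝ)) +
        (∑ d ∈ q.divisors, (d : ℝ)) * ∑ e ∈ r.divisors, (e : ℝ) := by
        simp_rw [Finset.sum_mul_sum, Finset.sum_add_distrib, Finset.mul_sum]
    _ = _ := by
        rw [sum_sum_moebius_mul_gcd hq hr, mul_ite, mul_zero]

/-- The number of primes of the form `k m + 1` with `1 ≤ k ≤ K`. -/
def primeMultipleCount (m K : ℕ) : ℕ :=
  ((Finset.Icc 1 K).filter fun k => (k * m + 1).Prime).card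

/-- The large values of the sieve weights bound the number of primes. -/
theorem primeMultipleCount_sub_mul_sq_le (m K z : ℕ) (hm : m ≠ 0) :
    ((primeMultipleCount m K : ℝ) - z) * (∑ d ∈ sqfreeCoprime m z, (d : ℝ)⁻¹) ^ 2 ≤
      K * (∑ d ∈ sqfreeCoprime m z, (d : ℝ)⁻¹) + (2 * z) ^ 2 := by
  set D := sqfreeCoprime m z with hD
  set H := ∑ d ∈ D, (d : ℝ)⁻¹ with hH
  have hDmem : ∀ d ∈ D, (1 ≤ d ∧ d ≤ z) ∧ Squarefree d ∧ d.Coprime m := by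
    intro d hd
    simpa [hD, sqfreeCoprime] using hd
  let w : ℕ → ℝ := fun k => ∑ d ∈ D, (d : ℝ)⁻¹ * moebiusDivisorSum d (k * m + 1)
  let S := (Finset.Icc 1 K).filter fun k => (k * m + 1).Prime ∧ z < k
  have hS : (primeMultipleCount m K : ℝ) - z ≤ S.card := by
    have h : primeMultipleCount m K ≤ S.card + z := by
      calc primeMultipleCount m K ≤ (S ∪ Finset.Icc 1 z).card := by
            refine Finset.card_le_card fun k hk => ?_
            simp only [S, Finset.mem_union, Finset.mem_filter, Finset.mem_Icc] at hk ⊢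
            rcases lt_or_ge z k with h | h
            · exact Or.inl ⟨hk.1, hk.2, h⟩
            · exact Or.inr ⟨hk.1.1, h⟩
        _ ≤ _ := by simpa using Finset.card_union_le S (Finset.Icc 1 z)
    rw [sub_le_iff_le_add]
    exact_mod_cast h
  have hw : ∀ k ∈ S, w k = H := by
    intro k hk
    simp only [S, Finset.mem_filter, Finset.mem_Icc] at hk
    refine Finset.sum_congr rfl fun d hd => ?_
    obtain ⟨⟨h1, h2⟩, -⟩ := hDmem d hd
    have hkm : k ≤ k * m := Nat.le_mul_of_pos_right k (Nat.pos_of_ne_zero hm)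
    rw [moebiusDivisorSum_of_coprime (by lia), mul_one]
    exact (Nat.coprime_of_lt_prime (by lia) (by lia) hk.2.1).symm
  calc _ ≤ (S.card : ℝ) * H ^ 2 := by gcongr
    _ = ∑ k ∈ S, w k ^ 2 := by
        rw [Finset.sum_congr rfl fun k hk => by rw [hw k hk], Finset.sum_const, nsmul_eq_mul]
    _ ≤ ∑ k ∈ Finset.Icc 1 K, w k ^ 2 :=
        Finset.sum_le_sum_of_subset_of_nonneg (Finset.filter_subset _ _)
          fun _ _ _ => sq_nonneg _
    _ = ∑ q ∈ D, ∑ r ∈ D, (q : ℝ)⁻¹ * (r : ℝ)⁻¹ * ∑ k ∈ Finset.Icc 1 K,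
          moebiusDivisorSum q (k * m + 1) * moebiusDivisorSum r (k * m + 1) := by
        simp_rw [w, sq, Finset.sum_mul_sum, Finset.mul_sum]
        rw [Finset.sum_comm]
        refine Finset.sum_congr rfl fun q _ => ?_
        rw [Finset.sum_comm]
        refine Finset.sum_congr rfl fun r _ => Finset.sum_congr rfl fun k _ => ?_
        ring
    _ ≤ ∑ q ∈ D, ∑ r ∈ D, (q : ℝ)⁻¹ * (r : ℝ)⁻¹ *
          ((if q = r then (K : ℝ) * q.totient else 0) +
            (∑ d ∈ q.divisors, (d : ℝ)) * ∑ e ∈ r.divisors, (e : ℝ)) := by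
        refine Finset.sum_le_sum fun q hq => Finset.sum_le_sum fun r hr => ?_
        obtain ⟨-, hq1, hq2⟩ := hDmem q hq
        obtain ⟨-, hr1, hr2⟩ := hDmem r hr
        gcongr
        exact sum_moebiusDivisorSum_mul_le hq1 hr1 hq2 hr2 K
    _ = ∑ q ∈ D, (K : ℝ) * ((q : ℝ)⁻¹ * (q : ℝ)⁻¹ * q.totient) +
          (∑ q ∈ D, sumInvDivisors q) ^ 2 := by
        simp_rw [mul_add, Finset.sum_add_distrib]
        congr 1
        · refine Finset.sum_congr rfl fun q hq => ?_
          simp only [mul_ite, mul_zero, Finset.sum_ite_eq, hq, if_true]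
          ring
        · rw [sq, Finset.sum_mul_sum]
          refine Finset.sum_congr rfl fun q _ => Finset.sum_congr rfl fun r _ => ?_
          rw [sumInvDivisors_eq_sum_div, sumInvDivisors_eq_sum_div]
          ring
    _ ≤ _ := by
        gcongr ?_ + ?_ ^ 2
        · rw [← Finset.mul_sum]
          refine mul_le_mul_of_nonneg_left (Finset.sum_le_sum fun q hq => ?_) (by positivity)
          have hq0 : (0 : ℝ) < q := by exact_mod_cast (hDmem q hq).1.1
          have : (q.totient : ℝ) ≤ q := by exact_mod_cast Nat.totient_le q
          calc (q : ℝ)⁻¹ * (q : ℝ)⁻¹ * q.totient ≤ (q : ℝ)⁻¹ * (q : ℝ)⁻¹ * q := by gcongr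
            _ = (q : ℝ)⁻¹ := by field_simp
        · exact Finset.sum_nonneg fun _ _ => sumInvDivisors_nonneg _
        · exact (Finset.sum_le_sum_of_subset_of_nonneg (Finset.filter_subset _ _)
            fun _ _ _ => sumInvDivisors_nonneg _).trans (sum_sumInvDivisors_le z)

/-- A Brun–Titchmarsh inequality, with `σ(m) / m` in place of `m / φ(m)`. -/
theorem primeMultipleCount_le {m K : ℕ} (hm : m ≠ 0) (hK : K ≠ 0) :
    (primeMultipleCount m K : ℝ) ≤ 23 * sumInvDivisors m * (K / Real.log (K + 1)) := by
  set z := K.sqrt.sqrt with hz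
  have hz1 : 1 ≤ z := Nat.sqrt_pos.2 (Nat.sqrt_pos.2 (Nat.pos_of_ne_zero hK))
  have hzK : z ^ 4 ≤ K := by
    have h1 := Nat.sqrt_le' K.sqrt
    have h2 := Nat.sqrt_le' K
    calc z ^ 4 = (z ^ 2) ^ 2 := by ring
      _ ≤ K.sqrt ^ 2 := Nat.pow_le_pow_left h1 2
      _ ≤ K := h2
  have hKz : K + 1 ≤ (z + 1) ^ 4 := by
    have h1 : K.sqrt + 1 ≤ (z + 1) ^ 2 := Nat.lt_succ_sqrt' K.sqrt
    have h2 : K + 1 ≤ (K.sqrt + 1) ^ 2 := Nat.lt_succ_sqrt' K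
    calc K + 1 ≤ (K.sqrt + 1) ^ 2 := h2
      _ ≤ ((z + 1) ^ 2) ^ 2 := Nat.pow_le_pow_left h1 2
      _ = _ := by ring
  have hsieve := primeMultipleCount_sub_mul_sq_le m K z hm
  have hlog := log_le_two_mul_sumInvDivisors_mul_sum hm z
  set H := ∑ d ∈ sqfreeCoprime m z, (d : ℝ)⁻¹ with hH
  have hH1 : 1 ≤ H := by
    have h1 : 1 ∈ sqfreeCoprime m z := by simp [sqfreeCoprime, hz1]
    have := Finset.single_le_sum (f := fun d : ℕ => (d : ℝ)⁻¹) (fun _ _ => by positivity) h1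
    simpa using this
  have hR := one_le_sumInvDivisors hm
  set R := sumInvDivisors m
  have hKpos : (0 : ℝ) < K := by exact_mod_cast Nat.pos_of_ne_zero hK
  have hK1 : (1 : ℝ) ≤ K := by exact_mod_cast Nat.pos_of_ne_zero hK
  have hL : 0 < Real.log (K + 1) := Real.log_pos (by linarith)
  have hL4 : Real.log (K + 1) ≤ 8 * R * H := by
    have h1 : ((K : ℝ) + 1) ≤ ((z : ℝ) + 1) ^ 4 := by exact_mod_cast hKz
    have h2 := Real.log_le_log (by linarith) h1
    rw [Real.log_pow] at h2
    push_cast at h2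
    linarith
  have hz2 : (z : ℝ) ^ 2 ≤ √K := by
    apply Real.le_sqrt_of_sq_le
    rw [← pow_mul]
    exact_mod_cast hzK
  have hLs : Real.log (K + 1) ≤ 3 * √K := by
    have h0 : 0 < √((K : ℝ) + 1) := Real.sqrt_pos.2 (by linarith)
    have h1 : Real.log (K + 1) = 2 * Real.log (√((K : ℝ) + 1)) := by
      rw [Real.log_sqrt (by linarith)]; ring
    have h2 := Real.log_le_sub_one_of_pos h0
    have h3 : √((K : ℝ) + 1) ≤ 3 / 2 * √K := by
      rw [Real.sqrt_le_left (by positivity), mul_pow, Real.sq_sqrt hKpos.le]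
      linarith
    linarith
  have hsq : √K ≤ 3 * (K / Real.log (K + 1)) := by
    rw [← mul_div_assoc, le_div_iff₀ hL]
    calc √K * Real.log (K + 1) ≤ √K * (3 * √K) := by gcongr
      _ = 3 * (√K * √K) := by ring
      _ = 3 * K := by rw [Real.mul_self_sqrt hKpos.le]
  have hmain : (K : ℝ) / H ≤ 8 * R * (K / Real.log (K + 1)) := by
    rw [← mul_div_assoc, div_le_div_iff₀ (by linarith) hL]
    calc (K : ℝ) * Real.log (K + 1) ≤ K * (8 * R * H) := by gcongr
      _ = _ := by ring
  have hz1' : (1 : ℝ) ≤ z := by exact_mod_cast hz1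
  have hF : (primeMultipleCount m K : ℝ) - z ≤ K / H + 4 * (z : ℝ) ^ 2 := by
    have hH2 : 0 < H ^ 2 := by positivity
    refine le_of_mul_le_mul_right (hsieve.trans ?_) hH2
    have e : ((K : ℝ) / H + 4 * (z : ℝ) ^ 2) * H ^ 2 = K * H + 4 * (z : ℝ) ^ 2 * H ^ 2 := by
      field_simp
    rw [e]
    have : (1 : ℝ) ≤ H ^ 2 := one_le_pow₀ hH1
    nlinarith [mul_le_mul_of_nonneg_left this (by positivity : 0 ≤ 4 * (z : ℝ) ^ 2)]
  have hQ : 0 ≤ (K : ℝ) / Real.log (K + 1) := by positivity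
  calc (primeMultipleCount m K : ℝ) ≤ K / H + 4 * (z : ℝ) ^ 2 + z := by linarith
    _ ≤ K / H + 5 * √K := by nlinarith
    _ ≤ 8 * R * (K / Real.log (K + 1)) + 15 * (1 * (K / Real.log (K + 1))) := by linarith
    _ ≤ 8 * R * (K / Real.log (K + 1)) + 15 * (R * (K / Real.log (K + 1))) := by gcongr
    _ = _ := by ring

open MeasureTheory intervalIntegral

theorem primesInAP_one_le {m k : ℕ} (hm : m ≠ 0) {t : ℝ} (ht : t < (k + 1) * m + 1) :
    primesInAP t m 1 ≤ primeMultipleCount m k := by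
  rw [primesInAP, primeMultipleCount,
    ← Finset.card_image_of_injective (f := fun j => j * m + 1)
      ((Finset.Icc 1 k).filter fun k => (k * m + 1).Prime)
      (fun a b h => Nat.eq_of_mul_eq_mul_right (Nat.pos_of_ne_zero hm) (Nat.succ_injective h))]
  refine Finset.card_le_card fun p hp => ?_
  simp only [Finset.mem_filter, Finset.mem_Iic, Finset.mem_image, Finset.mem_Icc] at hp ⊢
  obtain ⟨hpt, hp, hpm⟩ := hp
  obtain ⟨j, hj⟩ := (Nat.modEq_iff_dvd' hp.one_lt.le).1 hpm.symm
  have hpj : p = j * m + 1 := by rw [mul_comm, ← hj]; have := hp.one_lt; lia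
  have hlt : p < (k + 1) * m + 1 := by
    have h1 : (p : ℝ) ≤ t := (Nat.le_floor_iff' hp.ne_zero).1 hpt
    exact_mod_cast h1.trans_lt ht
  refine ⟨j, ⟨⟨?_, ?_⟩, hpj ▸ hp⟩, hpj.symm⟩
  · rcases Nat.eq_zero_or_pos j with rfl | h
    · simp only [zero_mul, zero_add] at hpj
      exact absurd hpj hp.one_lt.ne'
    · exact h
  · have : j * m < (k + 1) * m := by lia
    have := Nat.lt_of_mul_lt_mul_right this
    lia

theorem monotone_primesInAP (m a : ℕ) : Monotone fun t => (primesInAP t m a : ℝ) := by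
  intro s t hst
  have : primesInAP s m a ≤ primesInAP t m a :=
    Finset.card_le_card (Finset.filter_subset_filter _
      (Finset.Iic_subset_Iic.2 (Nat.floor_le_floor hst)))
  exact Nat.cast_le.2 this

theorem intervalIntegrable_primesInAP_div (m a : ℕ) {b c : ℝ} (hb : 1 < b) (hbc : b ≤ c) :
    IntervalIntegrable (fun t => (primesInAP t m a : ℝ) / (t - 1) ^ 2) volume b c := by
  simp_rw [div_eq_mul_inv]
  refine (monotone_primesInAP m a).intervalIntegrable.mul_continuousOn ?_
  refine ContinuousOn.inv₀ (by fun_prop) fun t ht => ?_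
  rw [Set.uIcc_of_le hbc] at ht
  have : 0 < t - 1 := by linarith [ht.1]
  positivity

theorem integral_primesInAP_le_sum {m : ℕ} (hm : m ≠ 0) (N : ℕ) :
    ∫ t in (2 : ℝ)..((N + 1) * m + 1), (primesInAP t m 1 : ℝ) / (t - 1) ^ 2 ≤
      (∑ k ∈ Finset.Icc 1 N, (primeMultipleCount m k : ℝ) / (k : ℝ) ^ 2) / m := by
  have hm1 : (1 : ℝ) ≤ m := by exact_mod_cast Nat.pos_of_ne_zero hm
  induction N with
  | zero =>
    have h : ∫ t in (2 : ℝ)..(((0 : ℕ) + 1) * m + 1), (primesInAP t m 1 : ℝ) / (t - 1) ^ 2 ≤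
        ∫ _ in (2 : ℝ)..(((0 : ℕ) + 1) * m + 1), (0 : ℝ) := by
      refine integral_mono_on_of_le_Ioo (by push_cast; linarith)
        (intervalIntegrable_primesInAP_div m 1 (by norm_num) (by push_cast; linarith))
        intervalIntegrable_const fun t ht => ?_
      have h0 := primesInAP_one_le hm (k := 0) ht.2
      have h1 : primesInAP t m 1 = 0 := by simpa [primeMultipleCount] using h0
      simp [h1]
    simpa using h
  | succ N ih =>
    have h2 : (2 : ℝ) ≤ (N + 1) * m + 1 := by nlinarith [(Nat.cast_nonneg N : (0 : ℝ) ≤ N)]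
    have h3 : ((N : ℝ) + 1) * m + 1 ≤ ((N + 1 : ℕ) + 1) * m + 1 := by push_cast; nlinarith
    rw [← integral_add_adjacent_intervals
      (intervalIntegrable_primesInAP_div m 1 (by norm_num) h2)
      (intervalIntegrable_primesInAP_div m 1 (by linarith) h3),
      Finset.sum_Icc_succ_top (by lia), add_div]
    refine add_le_add ih ?_
    have h : ∫ t in ((N : ℝ) + 1) * m + 1..((N + 1 : ℕ) + 1) * m + 1,
          (primesInAP t m 1 : ℝ) / (t - 1) ^ 2 ≤
        ∫ _ in ((N : ℝ) + 1) * m + 1..((N + 1 : ℕ) + 1) * m + 1,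
          (primeMultipleCount m (N + 1) : ℝ) / (((N : ℝ) + 1) * m) ^ 2 := by
      refine integral_mono_on_of_le_Ioo h3
        (intervalIntegrable_primesInAP_div m 1 (by linarith) h3)
        intervalIntegrable_const fun t ht => ?_
      have h0 : (primesInAP t m 1 : ℝ) ≤ primeMultipleCount m (N + 1) := by
        exact_mod_cast primesInAP_one_le hm ht.2
      have h1 : ((N : ℝ) + 1) * m ≤ t - 1 := by linarith [ht.1]
      gcongr
    refine h.trans (le_of_eq ?_)
    rw [intervalIntegral.integral_const, smul_eq_mul]
    push_cast
    field_simp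
    ring

theorem integral_primesInAP_nonneg (m a : ℕ) {b : ℝ} (hb : 2 ≤ b) :
    0 ≤ ∫ t in (2 : ℝ)..b, (primesInAP t m a : ℝ) / (t - 1) ^ 2 :=
  integral_nonneg hb fun _ _ => by positivity

theorem integral_primesInAP_sq_le {m N : ℕ} (hm : m ≠ 0) {ε : ℝ} (hε : 0 < ε)
    (hN : (m : ℝ) ^ ε ≤ N + 1) :
    (∫ t in (2 : ℝ)..((m : ℝ) ^ (1 + ε)), (primesInAP t m 1 : ℝ) / (t - 1) ^ 2) ^ 2 ≤
      ((∑ k ∈ Finset.Icc 1 N, (primeMultipleCount m k : ℝ) / (k : ℝ) ^ 2) / m) ^ 2 := by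
  rcases eq_or_ne m 1 with rfl | hm1
  · have h : ∫ t in (2 : ℝ)..(((1 : ℕ) : ℝ) ^ (1 + ε)), (primesInAP t 1 1 : ℝ) / (t - 1) ^ 2 =
        ∫ _ in (2 : ℝ)..(((1 : ℕ) : ℝ) ^ (1 + ε)), (0 : ℝ) := by
      refine integral_congr_uIoo fun t ht => ?_
      have ht2 : t < 2 := by
        rw [Nat.cast_one, Real.one_rpow, Set.uIoo_of_ge (by norm_num)] at ht
        exact ht.2
      have h0 := primesInAP_one_le (m := 1) (k := 0) one_ne_zero (t := t)
        (by push_cast; linarith)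
      have h1 : primesInAP t 1 1 = 0 := by simpa [primeMultipleCount] using h0
      simp [h1]
    rw [h]
    rw [intervalIntegral.integral_zero, zero_pow two_ne_zero]
    positivity
  · have hm2 : (2 : ℝ) ≤ m := by
      have : 2 ≤ m := by lia
      exact_mod_cast this
    have hb : (2 : ℝ) ≤ (m : ℝ) ^ (1 + ε) := hm2.trans
      (Real.self_le_rpow_of_one_le (by linarith) (by linarith))
    have hbN : (m : ℝ) ^ (1 + ε) ≤ (N + 1) * m + 1 := by
      rw [Real.rpow_add (by linarith), Real.rpow_one]
      nlinarith
    refine pow_le_pow_left₀ (integral_primesInAP_nonneg m 1 hb) ?_ 2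
    refine le_trans ?_ (integral_primesInAP_le_sum hm N)
    exact integral_mono_interval le_rfl hb hbN
      (Filter.Eventually.of_forall fun t => by simp only [Pi.zero_apply]; positivity)
      (intervalIntegrable_primesInAP_div m 1 (by norm_num) (hb.trans hbN))

/-- The sum `∑_{k ≤ N} 1 / (k √(log (k + 1)))`. -/
noncomputable def sumInvSqrtLog (N : ℕ) : ℝ :=
  ∑ k ∈ Finset.Icc 1 N, ((k : ℝ) * √(Real.log (k + 1)))⁻¹

theorem sumInvSqrtLog_nonneg (N : ℕ) : 0 ≤ sumInvSqrtLog N :=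
  Finset.sum_nonneg fun _ _ => by positivity

theorem sumInvSqrtLog_le (N : ℕ) : sumInvSqrtLog N ≤ 4 * √(Real.log (N + 1)) := by
  induction N with
  | zero => simp [sumInvSqrtLog]
  | succ N ih =>
    rw [sumInvSqrtLog, Finset.sum_Icc_succ_top (by lia), ← sumInvSqrtLog]
    push_cast
    have hN : (0 : ℝ) ≤ N := Nat.cast_nonneg N
    set A := √(Real.log (N + 1))
    set B := √(Real.log (N + 1 + 1))
    have hA2 : A ^ 2 = Real.log (N + 1) := Real.sq_sqrt (Real.log_nonneg (by linarith))
    have hB2 : B ^ 2 = Real.log (N + 1 + 1) := Real.sq_sqrt (Real.log_nonneg (by linarith))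
    have hB : 0 < B := Real.sqrt_pos.2 (Real.log_pos (by linarith))
    have hA : 0 ≤ A := Real.sqrt_nonneg _
    have hAB : A ≤ B := Real.sqrt_le_sqrt (Real.log_le_log (by linarith) (by linarith))
    have hdiff : 1 / (2 * ((N : ℝ) + 1)) ≤ B ^ 2 - A ^ 2 := by
      rw [hA2, hB2, ← Real.log_div (by positivity) (by positivity)]
      have h := Real.one_sub_inv_le_log_of_pos
        (x := ((N : ℝ) + 1 + 1) / (N + 1)) (by positivity)
      refine le_trans ?_ h
      rw [inv_div, one_sub_div (by positivity), div_le_div_iff₀ (by positivity) (by positivity)]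
      linarith
    have hinv : (((N : ℝ) + 1) * B)⁻¹ ≤ 4 * (B - A) := by
      rw [mul_inv, ← div_eq_mul_inv, div_le_iff₀ hB]
      have e : ((N : ℝ) + 1)⁻¹ = 2 * (1 / (2 * ((N : ℝ) + 1))) := by field_simp
      rw [e]
      nlinarith
    linarith

theorem totient_mul_integral_sq_le {m N : ℕ} (hm : m ≠ 0) {ε : ℝ} (hε : 0 < ε)
    (hN : (m : ℝ) ^ ε ≤ N + 1) :
    (m.totient : ℝ) *
        (∫ t in (2 : ℝ)..((m : ℝ) ^ (1 + ε)), (primesInAP t m 1 : ℝ) / (t - 1) ^ 2) ^ 2 ≤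
      23 * sumInvSqrtLog N / m * ∑ k ∈ Finset.Icc 1 N,
        (primeMultipleCount m k : ℝ) / ((k : ℝ) ^ 2 * √(Real.log (k + 1))) := by
  have hm0 : (0 : ℝ) < m := by exact_mod_cast Nat.pos_of_ne_zero hm
  have hlog : ∀ k ∈ Finset.Icc 1 N, (0 : ℝ) < k ∧ 0 < Real.log ((k : ℝ) + 1) := by
    intro k hk
    have : (0 : ℝ) < k := by exact_mod_cast (Finset.mem_Icc.1 hk).1
    exact ⟨this, Real.log_pos (by linarith)⟩
  set G := ∑ k ∈ Finset.Icc 1 N,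
    (primeMultipleCount m k : ℝ) / ((k : ℝ) ^ 2 * √(Real.log (k + 1)))
  have hG0 : 0 ≤ G := Finset.sum_nonneg fun _ _ => by positivity
  have hcs : (∑ k ∈ Finset.Icc 1 N, (primeMultipleCount m k : ℝ) / (k : ℝ) ^ 2) ^ 2 ≤
      G * ∑ k ∈ Finset.Icc 1 N,
        (primeMultipleCount m k : ℝ) * √(Real.log (k + 1)) / (k : ℝ) ^ 2 := by
    refine Finset.sum_sq_le_sum_mul_sum_of_sq_le_mul _ (fun _ _ => by positivity)
      (fun _ _ => by positivity) fun k hk => le_of_eq ?_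
    obtain ⟨hk0, hk1⟩ := hlog k hk
    have := Real.sqrt_pos.2 hk1
    field_simp
  have hbt : ∑ k ∈ Finset.Icc 1 N,
      (primeMultipleCount m k : ℝ) * √(Real.log (k + 1)) / (k : ℝ) ^ 2 ≤
      23 * sumInvDivisors m * sumInvSqrtLog N := by
    rw [sumInvSqrtLog, Finset.mul_sum]
    refine Finset.sum_le_sum fun k hk => ?_
    obtain ⟨hk0, hk1⟩ := hlog k hk
    have hs := Real.sqrt_pos.2 hk1
    have h := primeMultipleCount_le hm (K := k) (by exact_mod_cast hk0.ne')
    calc _ ≤ 23 * sumInvDivisors m * (k / Real.log (k + 1)) * √(Real.log (k + 1)) /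
          (k : ℝ) ^ 2 := by gcongr
      _ = 23 * sumInvDivisors m * (k / (√(Real.log (k + 1)) * √(Real.log (k + 1)))) *
          √(Real.log (k + 1)) / (k : ℝ) ^ 2 := by rw [Real.mul_self_sqrt hk1.le]
      _ = _ := by field_simp
  have hS := sumInvSqrtLog_nonneg N
  have hphi := totient_mul_sumInvDivisors_le m
  calc _ ≤ (m.totient : ℝ) *
        ((∑ k ∈ Finset.Icc 1 N, (primeMultipleCount m k : ℝ) / (k : ℝ) ^ 2) / m) ^ 2 := by
        exact mul_le_mul_of_nonneg_left (integral_primesInAP_sq_le hm hε hN) (by positivity)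
    _ ≤ (m.totient : ℝ) * ((G * (23 * sumInvDivisors m * sumInvSqrtLog N)) / (m : ℝ) ^ 2) := by
        rw [div_pow]
        gcongr
        exact hcs.trans (by gcongr)
    _ = ((m.totient : ℝ) * sumInvDivisors m) * (23 * sumInvSqrtLog N * G / (m : ℝ) ^ 2) := by
        ring
    _ ≤ m * (23 * sumInvSqrtLog N * G / (m : ℝ) ^ 2) := by gcongr
    _ = _ := by field_simp

theorem sum_primeMultipleCount_le {M : ℕ} (hM : M ≠ 0) (k : ℕ) :
    ∑ m ∈ Finset.Icc 1 M, (primeMultipleCount m k : ℝ) ≤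
      46 * k * (M / Real.log (M + 1)) := by
  have hswap : ∑ m ∈ Finset.Icc 1 M, (primeMultipleCount m k : ℝ) =
      ∑ j ∈ Finset.Icc 1 k, (primeMultipleCount j M : ℝ) := by
    simp_rw [primeMultipleCount, Finset.card_filter, Nat.cast_sum]
    rw [Finset.sum_comm]
    refine Finset.sum_congr rfl fun j _ => Finset.sum_congr rfl fun m _ => ?_
    rw [mul_comm]
  have hlog : 0 ≤ Real.log ((M : ℝ) + 1) :=
    Real.log_nonneg (by linarith [(Nat.cast_nonneg M : (0 : ℝ) ≤ M)])
  rw [hswap]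
  calc _ ≤ ∑ j ∈ Finset.Icc 1 k, 23 * sumInvDivisors j * (M / Real.log (M + 1)) := by
        refine Finset.sum_le_sum fun j hj => primeMultipleCount_le ?_ hM
        have := (Finset.mem_Icc.1 hj).1
        lia
    _ = 23 * (∑ j ∈ Finset.Icc 1 k, sumInvDivisors j) * (M / Real.log (M + 1)) := by
        rw [Finset.mul_sum, Finset.sum_mul]
    _ ≤ 23 * (2 * k) * (M / Real.log (M + 1)) := by
        gcongr
        exact sum_sumInvDivisors_le k
    _ = _ := by ring

theorem sum_dyadic_totient_mul_integral_sq_le (i : ℕ) {ε : ℝ} (hε : 0 < ε) :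
    ∑ m ∈ Finset.Ico (2 ^ i) (2 ^ (i + 1)), (m.totient : ℝ) *
        (∫ t in (2 : ℝ)..((m : ℝ) ^ (1 + ε)), (primesInAP t m 1 : ℝ) / (t - 1) ^ 2) ^ 2 ≤
      67712 * (((i : ℝ) + 1)⁻¹ + ε) := by
  set M : ℕ := 2 ^ (i + 1) with hM
  set N : ℕ := ⌊(M : ℝ) ^ ε⌋₊ with hN
  have hM0 : M ≠ 0 := by positivity
  have hM1 : (1 : ℝ) ≤ M := by exact_mod_cast Nat.pos_of_ne_zero hM0
  have hS := sumInvSqrtLog_nonneg N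
  have hlog2 : Real.log 2 ≤ 1 := Real.log_two_lt_d9.le.trans (by norm_num)
  have hlog2' : 1 / 2 ≤ Real.log 2 := le_trans (by norm_num) Real.log_two_gt_d9.le
  have hlogM : Real.log M = (i + 1) * Real.log 2 := by
    rw [hM]; push_cast; rw [← Nat.cast_ofNat, Real.log_pow]; push_cast; ring
  have hlogM1 : ((i : ℝ) + 1) / 2 ≤ Real.log (M + 1) := by
    calc ((i : ℝ) + 1) / 2 = (i + 1) * (1 / 2) := by ring
      _ ≤ (i + 1) * Real.log 2 := by gcongr
      _ = Real.log M := hlogM.symm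
      _ ≤ Real.log (M + 1) := Real.log_le_log (by linarith) (by linarith)
  have hSN : sumInvSqrtLog N ^ 2 ≤ 16 * (1 + ε * (i + 1)) := by
    have hP : (1 : ℝ) ≤ (M : ℝ) ^ ε := Real.one_le_rpow hM1 hε.le
    have hN1 : (N : ℝ) + 1 ≤ 2 * (M : ℝ) ^ ε := by
      have := Nat.floor_le (a := (M : ℝ) ^ ε) (by positivity)
      linarith
    have hl : Real.log (N + 1) ≤ 1 + ε * (i + 1) := by
      have h1 := Real.log_le_log (by positivity) hN1
      rw [Real.log_mul (by norm_num) (by positivity), Real.log_rpow (by linarith), hlogM] at h1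
      have h2 : ε * (((i : ℝ) + 1) * Real.log 2) ≤ ε * (((i : ℝ) + 1) * 1) := by gcongr
      linarith
    calc sumInvSqrtLog N ^ 2 ≤ (4 * √(Real.log (N + 1))) ^ 2 :=
          pow_le_pow_left₀ hS (sumInvSqrtLog_le N) 2
      _ = 16 * Real.log (N + 1) := by
          rw [mul_pow, Real.sq_sqrt (Real.log_nonneg (by
            linarith [(Nat.cast_nonneg N : (0 : ℝ) ≤ N)]))]
          norm_num
      _ ≤ _ := by gcongr
  have hpow : (0 : ℝ) < 2 ^ i := by positivity
  calc _ ≤ ∑ m ∈ Finset.Ico (2 ^ i) M, 23 * sumInvSqrtLog N / 2 ^ i * ∑ k ∈ Finset.Icc 1 N,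
        (primeMultipleCount m k : ℝ) / ((k : ℝ) ^ 2 * √(Real.log (k + 1))) := by
        refine Finset.sum_le_sum fun m hm => ?_
        rw [Finset.mem_Ico] at hm
        have hm0 : 0 < m := lt_of_lt_of_le (by positivity) hm.1
        have hmi : (2 : ℝ) ^ i ≤ m := by exact_mod_cast hm.1
        have hmM : (m : ℝ) ≤ M := by exact_mod_cast hm.2.le
        have hmN : (m : ℝ) ^ ε ≤ N + 1 :=
          (Real.rpow_le_rpow (by positivity) hmM hε.le).trans (Nat.lt_floor_add_one _).le
        refine (totient_mul_integral_sq_le hm0.ne' hε hmN).trans ?_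
        gcongr
    _ ≤ ∑ m ∈ Finset.Icc 1 M, 23 * sumInvSqrtLog N / 2 ^ i * ∑ k ∈ Finset.Icc 1 N,
        (primeMultipleCount m k : ℝ) / ((k : ℝ) ^ 2 * √(Real.log (k + 1))) := by
        refine Finset.sum_le_sum_of_subset_of_nonneg (fun m hm => ?_) fun _ _ _ => ?_
        · rw [Finset.mem_Ico] at hm
          exact Finset.mem_Icc.2 ⟨lt_of_lt_of_le (by positivity) hm.1, hm.2.le⟩
        · exact mul_nonneg (by positivity) (Finset.sum_nonneg fun _ _ => by positivity)
    _ = 23 * sumInvSqrtLog N / 2 ^ i * ∑ k ∈ Finset.Icc 1 N,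
        (∑ m ∈ Finset.Icc 1 M, (primeMultipleCount m k : ℝ)) /
          ((k : ℝ) ^ 2 * √(Real.log (k + 1))) := by
        rw [← Finset.mul_sum, Finset.sum_comm]
        simp_rw [Finset.sum_div]
    _ ≤ 23 * sumInvSqrtLog N / 2 ^ i * ∑ k ∈ Finset.Icc 1 N,
        (184 * 2 ^ i / ((i : ℝ) + 1)) * ((k : ℝ) * √(Real.log (k + 1)))⁻¹ := by
        gcongr with k hk
        have hk0 : (0 : ℝ) < k := by exact_mod_cast (Finset.mem_Icc.1 hk).1
        have hs : 0 < √(Real.log ((k : ℝ) + 1)) := Real.sqrt_pos.2 (Real.log_pos (by linarith))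
        calc _ ≤ 46 * k * (M / Real.log (M + 1)) / ((k : ℝ) ^ 2 * √(Real.log (k + 1))) := by
              gcongr
              exact sum_primeMultipleCount_le hM0 k
          _ ≤ 46 * k * (M / (((i : ℝ) + 1) / 2)) / ((k : ℝ) ^ 2 * √(Real.log (k + 1))) := by
              gcongr
          _ = _ := by
              rw [hM]; push_cast; rw [pow_succ]; field_simp; norm_num
    _ = 4232 * sumInvSqrtLog N ^ 2 / ((i : ℝ) + 1) := by
        rw [← Finset.mul_sum, ← sumInvSqrtLog]
        field_simp
        ring
    _ ≤ 4232 * (16 * (1 + ε * (i + 1))) / ((i : ℝ) + 1) := by gcongr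
    _ = _ := by field_simp; norm_num

theorem sum_Icc_le_sum_dyadic {f : ℕ → ℝ} (hf : ∀ n, 0 ≤ f n) {n J : ℕ} (hn : n < 2 ^ J) :
    ∑ m ∈ Finset.Icc 1 n, f m ≤
      ∑ i ∈ Finset.range J, ∑ m ∈ Finset.Ico (2 ^ i) (2 ^ (i + 1)), f m := by
  have h : ∑ i ∈ Finset.range J, ∑ m ∈ Finset.Ico (2 ^ i) (2 ^ (i + 1)), f m =
      ∑ m ∈ Finset.Ico 1 (2 ^ J), f m := by
    clear hn
    induction J with
    | zero => simp
    | succ J ih =>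
      rw [Finset.sum_range_succ, ih]
      exact Finset.sum_Ico_consecutive f Nat.one_le_two_pow
        (Nat.pow_le_pow_right (by norm_num) (by lia))
  rw [h]
  refine Finset.sum_le_sum_of_subset_of_nonneg (fun m hm => ?_) fun _ _ _ => hf _
  rw [Finset.mem_Icc] at hm
  exact Finset.mem_Ico.2 ⟨hm.1, hm.2.trans_lt hn⟩

theorem proposition2 :
    ∃ C : ℝ, 0 < C ∧ ∃ ε₀ : ℝ, 0 < ε₀ ∧ ∃ x₀ : ℝ,
      ∀ ε : ℝ, 0 < ε → ε < ε₀ → ∀ x : ℝ, x₀ ≤ x →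
        ∑ m ∈ Finset.Icc 1 ⌊x ^ (1 - ε)⌋₊,
            (Nat.totient m : ℝ) *
              (∫ t in (2 : ℝ)..((m : ℝ) ^ (1 + ε)),
                (primesInAP t m 1 : ℝ) / (t - 1) ^ 2) ^ 2
          ≤ C * (ε * Real.log x + Real.log (Real.log x)) := by
  refine ⟨67712 * 4, by norm_num, 1, one_pos, Real.exp (Real.exp 1), fun ε hε _ x hx => ?_⟩
  have hx0 : 0 < x := (Real.exp_pos _).trans_le hx
  have hL : Real.exp 1 ≤ Real.log x := (Real.le_log_iff_exp_le hx0).2 hx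
  have he : (2 : ℝ) ≤ Real.exp 1 := le_trans (by norm_num) Real.exp_one_gt_d9.le
  have hL0 : 0 < Real.log x := by linarith
  have hLL : 1 ≤ Real.log (Real.log x) := (Real.le_log_iff_exp_le hL0).2 hL
  have hx1 : 1 ≤ x := by
    have := Real.log_le_sub_one_of_pos hx0
    linarith
  set n := ⌊x ^ (1 - ε)⌋₊ with hn
  set J := Nat.log 2 n + 1 with hJ
  have hnJ : n < 2 ^ J := Nat.lt_pow_succ_log_self (by norm_num) n
  have hJL : (J : ℝ) ≤ 3 * Real.log x := by
    have hnx : (n : ℝ) ≤ x := by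
      refine (Nat.floor_le (by positivity)).trans ?_
      calc x ^ (1 - ε) ≤ x ^ (1 : ℝ) := Real.rpow_le_rpow_of_exponent_le hx1 (by linarith)
        _ = x := Real.rpow_one x
    have hlog : (Nat.log 2 n : ℝ) ≤ 2 * Real.log x := by
      rcases Nat.eq_zero_or_pos n with h0 | hpos
      · rw [h0]; simp [hL0.le]
      · have h1 : ((2 : ℝ)) ^ Nat.log 2 n ≤ x :=
          le_trans (by exact_mod_cast Nat.pow_log_le_self 2 hpos.ne') hnx
        have h2 := Real.log_le_log (by positivity) h1
        rw [Real.log_pow] at h2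
        have h3 : 1 / 2 ≤ Real.log 2 := le_trans (by norm_num) Real.log_two_gt_d9.le
        have h4 : (Nat.log 2 n : ℝ) * (1 / 2) ≤ Nat.log 2 n * Real.log 2 := by gcongr
        linarith
    rw [hJ]
    push_cast
    linarith
  have hJ0 : (0 : ℝ) < J := by rw [hJ]; positivity
  have hharm : ∑ i ∈ Finset.range J, ((i : ℝ) + 1)⁻¹ ≤ 1 + Real.log J := by
    have h := harmonic_le_one_add_log J
    rw [harmonic] at h
    push_cast at h
    exact h
  have hlogJ : Real.log J ≤ 2 + Real.log (Real.log x) := by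
    have h := Real.log_le_log hJ0 hJL
    rw [Real.log_mul (by norm_num) hL0.ne'] at h
    have h3 := Real.log_le_sub_one_of_pos (x := 3) (by norm_num)
    linarith
  calc _ ≤ ∑ i ∈ Finset.range J, ∑ m ∈ Finset.Ico (2 ^ i) (2 ^ (i + 1)), (m.totient : ℝ) *
        (∫ t in (2 : ℝ)..((m : ℝ) ^ (1 + ε)), (primesInAP t m 1 : ℝ) / (t - 1) ^ 2) ^ 2 :=
        sum_Icc_le_sum_dyadic (f := fun m => (m.totient : ℝ) *
          (∫ t in (2 : ℝ)..((m : ℝ) ^ (1 + ε)), (primesInAP t m 1 : ℝ) / (t - 1) ^ 2) ^ 2)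
          (fun _ => by positivity) hnJ
    _ ≤ ∑ i ∈ Finset.range J, 67712 * (((i : ℝ) + 1)⁻¹ + ε) :=
        Finset.sum_le_sum fun i _ => sum_dyadic_totient_mul_integral_sq_le i hε
    _ = 67712 * (∑ i ∈ Finset.range J, ((i : ℝ) + 1)⁻¹ + ε * J) := by
        rw [← Finset.mul_sum, Finset.sum_add_distrib, Finset.sum_const, Finset.card_range,
          nsmul_eq_mul, mul_comm ε]
    _ ≤ 67712 * (4 * (ε * Real.log x + Real.log (Real.log x))) := by
        have h1 : ε * J ≤ ε * (3 * Real.log x) := by gcongr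
        have h2 : 0 < ε * Real.log x := by positivity
        gcongr
        linarith
    _ = _ := by ring
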